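/- Let $n\ge 1$. Consider polynomials with rational coefficients in the variables $x_{ij},\bar x_{ij}$ for $i\in[n]$, $j\in[2n]$ (pairs of twin variables), and let $\mathrm{ks}_i=\sum_{j\in[2n]}x_{ij}-n$. Let $Q_n$ be the set of polynomial constraints $$\mathrm{ks}_1=\tfrac12,\qquad \mathrm{ks}_i^2=\mathrm{ks}_{i+1}\ \ (1\le i\le n-1),\qquad \mathrm{ks}_n^2=0,$$ each identified with the polynomial $q$ (left side minus right side) for which it says $q=0$. A PCR/$\mathbb{Q}$ refutation of $Q_n$ is a finite sequence $p_1,\dots,p_\ell=1$ of such polynomials, in which each $p_i$ is justified in one of the following ways: it is an element of $Q_n$; it is a Boolean axiom $x^2-x$ or $x+\bar x-1$, where $x=x_{st}$ and $\bar x=\bar x_{st}$ for some $s\in[n]$, $t\in[2n]$; $p_i=y\,p_j$ for some $j<i$ and some variable $y$ (any $x_{st}$ or $\bar x_{st}$); or $p_i=a p_j+b p_k$ for some $j,k<i$ and $a,b\in\mathbb{Q}$. Its height is the length of the longest path from a leaf (a polynomial justified as an axiom) to $p_\ell$ in the directed acyclic graph given by the justifications. It is $R$-bounded if every coefficient of every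 $p_i$ and all scalars $a,b$ used in the linear combinations are at most $R$ in absolute value. **Theorem.** There are constants $c>0$ and $d>0$ such that for all large enough $n$, every $2^{2^{n/2}}$-bounded PCR/$\mathbb{Q}$ refutation of $Q_n$ in whose polynomials at most $2^{dn}$ distinct monomials occur has height at least $$2^{n/2-2}-\frac{cn+2\log_2 n}{2^{n/2+2}}-1.$$ -/

import Mathlib

noncomputable section

/-- Rational polynomials in the pairs of twin variables `x_s`, `x̄_s`, `s : σ`. The variable
`x_s` is `Sum.inl s` and its twin `x̄_s` is `Sum.inr s`. -/
abbrev TwinPoly (σ : Type*) := MvPolynomial (σ ⊕ σ) ℚ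

/-- The logical (Boolean) axioms: `x_s ^ 2 - x_s` and `x_s + x̄_s - 1` for every `s`. -/
def booleanAxioms (σ : Type*) : Set (TwinPoly σ) :=
  {p | ∃ s : σ, p = MvPolynomial.X (Sum.inl s) ^ 2 - MvPolynomial.X (Sum.inl s) ∨
    p = MvPolynomial.X (Sum.inl s) + MvPolynomial.X (Sum.inr s) - 1}

/-- The possible justifications of the `i`-th polynomial of a sequence `line` in a PCR proof over
the rationals from the constraints `q = 0`, `q ∈ Q`. -/
inductive PCRRule {σ : Type*} (Q : Set (TwinPoly σ)) {ℓ : ℕ} (line : Fin ℓ → TwinPoly σ)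
    (i : Fin ℓ) where
  /-- A non-logical axiom. -/
  | ax (h : line i ∈ Q)
  /-- A logical axiom. -/
  | logical (h : line i ∈ booleanAxioms σ)
  /-- Lifting of an earlier polynomial with a variable (of either kind). -/
  | lift (j : Fin ℓ) (hj : j < i) (x : σ ⊕ σ) (h : line i = MvPolynomial.X x * line j)
  /-- Linear combination of two (not necessarily distinct) earlier polynomials. -/
  | linComb (j k : Fin ℓ) (hj : j < i) (hk : k < i) (a b : ℚ)
      (h : line i = MvPolynomial.C a * line j + MvPolynomial.C b * line k)

/-- The scalars used by this step, if it is a linear combination, are at most `R` in absolute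
value. -/
def PCRRule.ScalarsLE {σ : Type*} {Q : Set (TwinPoly σ)} {ℓ : ℕ} {line : Fin ℓ → TwinPoly σ}
    {i : Fin ℓ} (R : ℝ) : PCRRule Q line i → Prop
  | .ax _ => True
  | .logical _ => True
  | .lift _ _ _ _ => True
  | .linComb _ _ _ _ a b _ => |(a : ℝ)| ≤ R ∧ |(b : ℝ)| ≤ R

/-- A PCR refutation over the rationals of `Q`: a nonempty sequence of polynomials whose last
member is `1`, together with a justification of every member. -/
structure PCRRefutation {σ : Type*} (Q : Set (TwinPoly σ)) where
  /-- The number of polynomials that precede the last one. -/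
  steps : ℕ
  /-- The polynomials of the refutation. -/
  line : Fin (steps + 1) → TwinPoly σ
  /-- The justification of each polynomial. -/
  rule : (i : Fin (steps + 1)) → PCRRule Q line i
  /-- The last polynomial is `1`. -/
  line_last : line (Fin.last steps) = 1

namespace PCRRefutation

variable {σ : Type*} {Q : Set (TwinPoly σ)}

/-- The height of the `i`-th polynomial: the length of the longest path from a leaf (an axiom) to
it in the directed acyclic graph given by the justifications. -/
def heightAt (Γ : PCRRefutation Q) (i : Fin (Γ.steps + 1)) : ℕ :=
  match Γ.rule i with
  | .ax _ => 0
  | .logical _ => 0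
  | .lift j _ _ _ => Γ.heightAt j + 1
  | .linComb j k _ _ _ _ _ => max (Γ.heightAt j) (Γ.heightAt k) + 1
termination_by i

/-- The height of a refutation: the height of its last polynomial. -/
def height (Γ : PCRRefutation Q) : ℕ := Γ.heightAt (Fin.last Γ.steps)

open Classical in
/-- The set of distinct monomials that occur (with a nonzero coefficient) in the polynomials of
the refutation. -/
def monomials (Γ : PCRRefutation Q) : Finset ((σ ⊕ σ) →₀ ℕ) :=
  Finset.univ.biUnion fun i => (Γ.line i).support

/-- A refutation is `R`-bounded if all coefficients of its polynomials and all scalars used in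
its linear combinations are at most `R` in absolute value. -/
def IsBounded (Γ : PCRRefutation Q) (R : ℝ) : Prop :=
  (∀ i m, |(((Γ.line i).coeff m : ℚ) : ℝ)| ≤ R) ∧ ∀ i, (Γ.rule i).ScalarsLE R

end PCRRefutation

/-- The index set of the twin pairs in `Q_n`: pairs `(i, j)` with `n` values of `i` and `2 n`
values of `j`. -/
abbrev KSIndex (n : ℕ) := Fin n × Fin (2 * n)

/-- The knapsack polynomial `ks_i = ∑_j x_{ij} - n`. -/
def ks (n : ℕ) (i : Fin n) : TwinPoly (KSIndex n) :=
  (∑ j : Fin (2 * n), MvPolynomial.X (Sum.inl (i, j))) - MvPolynomial.C (n : ℚ)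

/-- The constraints `Q_n` (each `q` in the set stands for `q = 0`): `ks_1 = 1/2`,
`ks_i ^ 2 = ks_{i+1}` for `1 ≤ i < n`, and `ks_n ^ 2 = 0`. The indices are shifted by one, so
that the first block has index `0` and the last one has index `n - 1`. -/
def knapsackConstraints (n : ℕ) : Set (TwinPoly (KSIndex n)) :=
  {q | (∃ i : Fin n, (i : ℕ) = 0 ∧ q = ks n i - MvPolynomial.C (1 / 2 : ℚ)) ∨
    (∃ i j : Fin n, (j : ℕ) = (i : ℕ) + 1 ∧ q = ks n i ^ 2 - ks n j) ∨
    (∃ i : Fin n, (i : ℕ) + 1 = n ∧ q = ks n i ^ 2)}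

end

/-! The axioms without the last one force `ks_i = (1/2)^(2^(i-1))`, so `ks_n^2 = 0` is violated only
by `2^(-2^n)`. The proof shows that deriving `1` from so small an error needs height, since each
inference amplifies the error by a bounded factor.

There are too few monomials to prevent a restriction from killing those of large degree. The `2n`
variables of a block form `n` couples. In each couple one variable stays free and the other gets a
bit, and for every literal one of these four choices sets it to zero. By a union bound some
restriction kills every monomial of the refutation touching more than `n/3` couples of one block
(`exists_killsHighDegree`).

The restricted lines are evaluated by designs: linear functionals on multilinear monomials that
behave, up to degree `d` in each block, as if the free variables of each block had a prescribed
non-integral sum. By induction on the lines, a line of height `h` has absolute value at most `(2R)^h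
* 2^(-2^n) * B` under every design bounded by `B` (`abs_designFunctional_line_le`). A linear
combination costs a factor `2R`. For a product with a literal, the literal is absorbed into the
design; this needs one more degree in one block, gained by inverting the inclusion matrix between
`d`-sets and `(d+1)`-sets (`IsKnapsackDesign.extendDesign`, `exists_design_of_literal_mul`). The
uniform design maps `1` to `1` and is bounded by `2^(n^2)`, whence `2^(2^n) ≤ (2R)^h * 2^(n^2)`. -/

/-! ### Block degrees and designs. -/

section Blocks

variable {β κ : Type*} [Fintype β] [DecidableEq β] [Fintype κ] [DecidableEq κ]

/-- The number of elements of `S` in the block `i`. -/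
def blockDeg (S : Finset (β × κ)) (i : β) : ℕ := (S.filter fun a => a.1 = i).card

/-- All block degrees of `S` are bounded by `D`. -/
def IsLow (D : β → ℕ) (S : Finset (β × κ)) : Prop := ∀ i, blockDeg S i ≤ D i

/-- The functional with value `φ S` at the multilinear monomial `S` annihilates the multiples of
`∑ k, x (i, k) - v i`, in block degrees at most `D`. -/
def IsKnapsackDesign (v : β → ℝ) (D : β → ℕ) (φ : Finset (β × κ) → ℝ) : Prop :=
  ∀ i S, IsLow D S → blockDeg S i < D i → ∑ k, φ (insert (i, k) S) = v i * φ S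

omit [Fintype β] [Fintype κ] in
lemma blockDeg_insert_of_ne (S : Finset (β × κ)) {i j : β} (k : κ) (h : i ≠ j) :
    blockDeg (insert (i, k) S) j = blockDeg S j := by
  simp [blockDeg, Finset.filter_insert, h]

omit [Fintype β] [Fintype κ] in
lemma blockDeg_insert_of_notMem {S : Finset (β × κ)} {i : β} {k : κ} (h : (i, k) ∉ S) :
    blockDeg (insert (i, k) S) i = blockDeg S i + 1 := by
  simp [blockDeg, Finset.filter_insert, h]

omit [Fintype β] [Fintype κ] in
lemma blockDeg_insert_le (S : Finset (β × κ)) (i : β) (k : κ) (j : β) :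
    blockDeg (insert (i, k) S) j ≤ blockDeg S j + if j = i then 1 else 0 := by
  by_cases h : i = j
  · subst h
    by_cases hk : (i, k) ∈ S
    · simp [Finset.insert_eq_of_mem hk]
    · simp [blockDeg_insert_of_notMem hk]
  · simp [blockDeg_insert_of_ne S k h]

omit [Fintype β] [Fintype κ] [DecidableEq κ] in
lemma blockDeg_mono {S T : Finset (β × κ)} (h : S ⊆ T) (i : β) : blockDeg S i ≤ blockDeg T i :=
  Finset.card_le_card (Finset.filter_subset_filter _ h)

/-- The elements of `S` in the block `b`. -/
def blockPart (S : Finset (β × κ)) (b : β) : Finset κ :=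
  Finset.univ.filter fun k => (b, k) ∈ S

omit [Fintype β] in
lemma mem_blockPart {S : Finset (β × κ)} {b : β} {k : κ} : k ∈ blockPart S b ↔ (b, k) ∈ S := by
  simp [blockPart]

omit [Fintype β] in
lemma card_blockPart (S : Finset (β × κ)) (b : β) : (blockPart S b).card = blockDeg S b := by
  rw [blockDeg, ← Finset.card_image_of_injective (blockPart S b) (Prod.mk_right_injective b)]
  congr 1
  ext ⟨i, k⟩
  simp only [Finset.mem_image, mem_blockPart, Prod.mk.injEq, Finset.mem_filter]
  constructor
  · rintro ⟨k, h, rfl, rfl⟩; exact ⟨h, rfl⟩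
  · rintro ⟨h, rfl⟩; exact ⟨k, h, rfl, rfl⟩

/-- Replace the part of `S` in the block `b` by `P`. -/
def replaceBlock (S : Finset (β × κ)) (b : β) (P : Finset κ) : Finset (β × κ) :=
  P.image (Prod.mk b) ∪ S.filter fun a => a.1 ≠ b

omit [Fintype β] [Fintype κ] in
lemma mem_replaceBlock {S : Finset (β × κ)} {b : β} {P : Finset κ} {a : β × κ} :
    a ∈ replaceBlock S b P ↔ (a.1 = b ∧ a.2 ∈ P) ∨ (a ∈ S ∧ a.1 ≠ b) := by
  obtain ⟨i, k⟩ := a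
  simp only [replaceBlock, Finset.mem_union, Finset.mem_image, Prod.mk.injEq, Finset.mem_filter]
  constructor
  · rintro (⟨k, h, rfl, rfl⟩ | h)
    · exact Or.inl ⟨rfl, h⟩
    · exact Or.inr h
  · rintro (⟨rfl, h⟩ | h)
    · exact Or.inl ⟨k, h, rfl, rfl⟩
    · exact Or.inr h

omit [Fintype β] in
lemma blockDeg_replaceBlock_self (S : Finset (β × κ)) (b : β) (P : Finset κ) :
    blockDeg (replaceBlock S b P) b = P.card := by
  rw [← card_blockPart]
  congr 1
  ext k
  simp [mem_blockPart, mem_replaceBlock]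

omit [Fintype β] [Fintype κ] in
lemma blockDeg_replaceBlock_of_ne (S : Finset (β × κ)) {b i : β} (P : Finset κ) (h : i ≠ b) :
    blockDeg (replaceBlock S b P) i = blockDeg S i := by
  rw [blockDeg, blockDeg]
  congr 1
  ext a
  simp only [Finset.mem_filter, mem_replaceBlock]
  constructor
  · rintro ⟨⟨h1, _⟩ | h1, h2⟩
    · exact absurd (h2.symm.trans h1) h
    · exact ⟨h1.1, h2⟩
  · rintro ⟨h1, h2⟩
    exact ⟨Or.inr ⟨h1, h2 ▸ h⟩, h2⟩

omit [Fintype β] [Fintype κ] in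
lemma replaceBlock_insert_self (S : Finset (β × κ)) (b : β) (k : κ) (P : Finset κ) :
    replaceBlock (insert (b, k) S) b P = replaceBlock S b P := by
  ext a
  simp only [mem_replaceBlock, Finset.mem_insert]
  constructor
  · rintro (h | ⟨rfl | h, h2⟩)
    · exact Or.inl h
    · exact absurd rfl h2
    · exact Or.inr ⟨h, h2⟩
  · rintro (h | ⟨h, h2⟩)
    · exact Or.inl h
    · exact Or.inr ⟨Or.inr h, h2⟩

omit [Fintype β] [Fintype κ] in
lemma replaceBlock_insert_of_ne (S : Finset (β × κ)) {b i : β} (k : κ) (P : Finset κ)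
    (h : i ≠ b) : replaceBlock (insert (i, k) S) b P = insert (i, k) (replaceBlock S b P) := by
  ext a
  simp only [mem_replaceBlock, Finset.mem_insert]
  constructor
  · rintro (h1 | ⟨h1 | h1, h2⟩)
    · exact Or.inr (Or.inl h1)
    · exact Or.inl h1
    · exact Or.inr (Or.inr ⟨h1, h2⟩)
  · rintro (h1 | h1 | ⟨h1, h2⟩)
    · subst h1; exact Or.inr ⟨Or.inl rfl, h⟩
    · exact Or.inl h1
    · exact Or.inr ⟨Or.inr h1, h2⟩

omit [Fintype β] in
lemma replaceBlock_blockPart (S : Finset (β × κ)) (b : β) :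
    replaceBlock S b (blockPart S b) = S := by
  ext ⟨i, k⟩
  simp only [mem_replaceBlock, mem_blockPart]
  by_cases h : i = b
  · subst h; simp
  · simp [h]

omit [Fintype β] in
lemma blockPart_insert_self (S : Finset (β × κ)) (b : β) (k : κ) :
    blockPart (insert (b, k) S) b = insert k (blockPart S b) := by
  ext l
  simp [mem_blockPart]

omit [Fintype β] in
lemma blockPart_insert_of_ne (S : Finset (β × κ)) {b i : β} (k : κ) (h : i ≠ b) :
    blockPart (insert (i, k) S) b = blockPart S b := by
  ext l
  simp [mem_blockPart, h.symm]

/-! ### Extending a design by one degree in one block. -/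

/-- Up to the sign, the coefficients `t ! / ((N - d) ⋯ (N - d - t))` of a left inverse of the
inclusion operator from the `d`-subsets to the `(d + 1)`-subsets of a set with `N` elements, at
pairs with `d - t` common elements. -/
noncomputable def inclusionCoeff (N d : ℕ) : ℕ → ℝ
  | 0 => 1 / ((N : ℝ) - d)
  | t + 1 => -(((t : ℝ) + 1) / ((N : ℝ) - d - (t + 1))) * inclusionCoeff N d t

/-- Successive coefficients have ratio `(t + 1) / (N - d - (t + 1))` up to sign, at most `1` since
`t + 1 ≤ d` and `3 * d ≤ N`. This is the reason for cutting degrees at a third of the block. -/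
lemma abs_inclusionCoeff_le_one {N d : ℕ} (hN : 0 < N) (h : 3 * d ≤ N) {t : ℕ} (ht : t ≤ d) :
    |inclusionCoeff N d t| ≤ 1 := by
  have h' : (3 : ℝ) * d ≤ N := by exact_mod_cast h
  induction t with
  | zero =>
    have h1 : (1 : ℝ) ≤ (N : ℝ) - d := by
      have : d + 1 ≤ N := by omega
      have : (d : ℝ) + 1 ≤ N := by exact_mod_cast this
      linarith
    rw [inclusionCoeff, abs_of_nonneg (by positivity), div_le_one (by linarith)]
    exact h1
  | succ t ih =>
    have ht' : (t : ℝ) + 1 ≤ d := by exact_mod_cast ht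
    have h0 : (0 : ℝ) ≤ t := Nat.cast_nonneg t
    have h2 : |((t : ℝ) + 1) / ((N : ℝ) - d - (t + 1))| ≤ 1 := by
      rw [abs_of_nonneg (div_nonneg (by linarith) (by linarith)), div_le_one (by linarith)]
      linarith
    rw [inclusionCoeff, abs_mul, abs_neg]
    exact mul_le_one₀ h2 (abs_nonneg _) (ih (by omega))

/-- With `d - |P ∩ R| = t + 1`, exactly `t + 1` of the `k ∉ R` lie in `P` and enlarge the
intersection, and the other `N - d - (t + 1)` do not. The recursion for the coefficients makes the
two contributions cancel. -/
lemma sum_inclusionCoeff {d : ℕ} (h : 2 * d < Fintype.card κ) {P R : Finset κ}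
    (hP : P.card = d) (hR : R.card = d) :
    ∑ k ∈ Rᶜ, inclusionCoeff (Fintype.card κ) d (d - (P ∩ insert k R).card)
      = if P = R then 1 else 0 := by
  set N := Fintype.card κ with hNdef
  set s := (P ∩ R).card with hs
  have h1 : ∀ k ∈ Rᶜ, inclusionCoeff N d (d - (P ∩ insert k R).card)
      = if k ∈ P then inclusionCoeff N d (d - (s + 1)) else inclusionCoeff N d (d - s) := by
    intro k hk
    by_cases hkP : k ∈ P
    · rw [if_pos hkP, Finset.inter_insert_of_mem hkP, Finset.card_insert_of_notMem]
      simp only [Finset.mem_compl] at hk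
      simp [hk]
    · rw [if_neg hkP, Finset.inter_insert_of_notMem hkP]
  have hPs : (P \ R).card + s = d := by rw [hs, Finset.card_sdiff_add_card_inter, hP]
  have hc1 : (Rᶜ.filter (· ∈ P)).card = d - s := by
    have : Rᶜ.filter (· ∈ P) = P \ R := by ext; simp [and_comm]
    rw [this]; omega
  have hc2 : (Rᶜ.filter (· ∉ P)).card + (d - s) = N - d := by
    have h3 := Finset.card_filter_add_card_filter_not (s := Rᶜ) (· ∈ P)
    rw [Finset.card_compl, hR, hc1] at h3
    omega
  rw [Finset.sum_congr rfl h1, Finset.sum_ite, Finset.sum_const, Finset.sum_const, hc1,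
    nsmul_eq_mul, nsmul_eq_mul]
  by_cases hPR : P = R
  · subst hPR
    have hsd : s = d := by rw [hs, Finset.inter_self, hP]
    have h4 : (Pᶜ.filter (· ∉ P)).card = N - d := by omega
    rw [h4, hsd, Nat.sub_self, if_pos rfl, inclusionCoeff, Nat.cast_sub (by omega)]
    have : (N : ℝ) - d ≠ 0 := by
      have : (2 : ℝ) * d < N := by exact_mod_cast h
      have : (0 : ℝ) ≤ d := Nat.cast_nonneg d
      intro; linarith
    field_simp
    simp
  · have hsd : s < d := by
      by_contra hcon
      apply hPR
      have : (P \ R).card = 0 := by omega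
      rw [Finset.card_eq_zero, Finset.sdiff_eq_empty_iff_subset] at this
      exact Finset.eq_of_subset_of_card_le this (by omega)
    obtain ⟨t, ht⟩ : ∃ t, d - s = t + 1 := ⟨d - s - 1, by omega⟩
    have ht2 : d - (s + 1) = t := by omega
    have h4 : (Rᶜ.filter (· ∉ P)).card + (t + 1) + d = N := by omega
    have h4' : (((Rᶜ.filter (· ∉ P)).card : ℕ) : ℝ) = (N : ℝ) - d - (t + 1) := by
      rw [← h4]; push_cast; ring
    have h5 : (N : ℝ) - d - (t + 1) ≠ 0 := by
      rw [← h4', Nat.cast_ne_zero]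
      omega
    rw [if_neg hPR, ht2, ht, h4', inclusionCoeff]
    push_cast
    field_simp
    ring

/-- The extension of a design by one degree in the block `b`. -/
noncomputable def extendDesign (v : β → ℝ) (D : β → ℕ) (b : β) (φ : Finset (β × κ) → ℝ)
    (T : Finset (β × κ)) : ℝ :=
  if blockDeg T b ≤ D b then φ T
  else (v b - D b) * ∑ P ∈ Finset.powersetCard (D b) Finset.univ,
    inclusionCoeff (Fintype.card κ) (D b) (D b - (P ∩ blockPart T b).card)
      * φ (replaceBlock T b P)

omit [Fintype β] in
lemma extendDesign_of_le {v : β → ℝ} {D : β → ℕ} {b : β} {φ : Finset (β × κ) → ℝ}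
    {T : Finset (β × κ)} (h : blockDeg T b ≤ D b) : extendDesign v D b φ T = φ T :=
  if_pos h

omit [Fintype β] in
lemma IsLow.replaceBlock {D : β → ℕ} {b : β} {S : Finset (β × κ)}
    (hS : IsLow (Function.update D b (D b + 1)) S) {P : Finset κ}
    (hP : P ∈ Finset.powersetCard (D b) Finset.univ) : IsLow D (replaceBlock S b P) := by
  intro i
  by_cases h : i = b
  · subst h
    rw [blockDeg_replaceBlock_self, (Finset.mem_powersetCard.1 hP).2]
  · rw [blockDeg_replaceBlock_of_ne _ _ h]
    simpa [h] using hS i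

omit [Fintype β] in
-- The only new equations in block `b` are those at degree exactly `D b`, and the left inverse of
-- the inclusion operator solves them. Equations of other blocks survive because the extension is
-- linear and acts on block `b` alone.
lemma IsKnapsackDesign.extendDesign {v : β → ℝ} {D : β → ℕ} {φ : Finset (β × κ) → ℝ}
    (hφ : IsKnapsackDesign v D φ) (b : β) (hb : 2 * D b < Fintype.card κ) :
    IsKnapsackDesign v (Function.update D b (D b + 1)) (extendDesign v D b φ) := by
  intro i S hS hi
  by_cases hSb : blockDeg S b ≤ D b
  · have hSlow : IsLow D S := by
      intro j
      by_cases hj : j = b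
      · exact hj ▸ hSb
      · simpa [hj] using hS j
    rw [extendDesign_of_le hSb]
    by_cases hib : i = b
    · subst hib
      rcases hSb.lt_or_eq with hlt | heq
      · rw [← hφ i S hSlow hlt]
        refine Finset.sum_congr rfl fun k _ => extendDesign_of_le ?_
        have := blockDeg_insert_le S i k i
        simp only [if_true] at this
        omega
      -- The `D i` elements already in `S` contribute `φ S` each, so the others must add up to `(v i
      -- - D i) * φ S`.
      · rw [← Finset.sum_add_sum_compl (blockPart S i)]
        have h1 : ∑ k ∈ blockPart S i, _root_.extendDesign v D i φ (insert (i, k) S)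
            = D i * φ S := by
          rw [← heq, ← card_blockPart, ← nsmul_eq_mul, ← Finset.sum_const]
          refine Finset.sum_congr rfl fun k hk => ?_
          rw [Finset.insert_eq_of_mem (mem_blockPart.1 hk), extendDesign_of_le hSb]
        have h2 : ∀ k ∈ (blockPart S i)ᶜ, _root_.extendDesign v D i φ (insert (i, k) S)
            = (v i - D i) * ∑ P ∈ Finset.powersetCard (D i) Finset.univ,
              inclusionCoeff (Fintype.card κ) (D i)
                (D i - (P ∩ insert k (blockPart S i)).card) * φ (replaceBlock S i P) := by
          intro k hk
          rw [Finset.mem_compl, mem_blockPart] at hk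
          rw [_root_.extendDesign, if_neg (by rw [blockDeg_insert_of_notMem hk]; omega)]
          simp only [blockPart_insert_self, replaceBlock_insert_self]
        rw [h1, Finset.sum_congr rfl h2, ← Finset.mul_sum, Finset.sum_comm]
        have h3 : ∀ P ∈ Finset.powersetCard (D i) (Finset.univ : Finset κ),
            ∑ k ∈ (blockPart S i)ᶜ, inclusionCoeff (Fintype.card κ) (D i)
                (D i - (P ∩ insert k (blockPart S i)).card) * φ (replaceBlock S i P)
              = if P = blockPart S i then φ S else 0 := by
          intro P hP
          rw [← Finset.sum_mul, sum_inclusionCoeff hb (Finset.mem_powersetCard.1 hP).2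
            ((card_blockPart S i).trans heq)]
          split_ifs with h
          · rw [h, replaceBlock_blockPart, one_mul]
          · rw [zero_mul]
        rw [Finset.sum_congr rfl h3, Finset.sum_ite_eq', if_pos]
        · ring
        · simp [Finset.mem_powersetCard, card_blockPart, heq]
    · rw [← hφ i S hSlow (by simpa [hib] using hi)]
      refine Finset.sum_congr rfl fun k _ => extendDesign_of_le ?_
      rw [blockDeg_insert_of_ne _ _ hib]
      exact hSb
  -- Here `S` has full degree in `b`, so the equation concerns another block, and it is inherited
  -- termwise from the sets `replaceBlock S b P`.
  · have hib : i ≠ b := by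
      rintro rfl
      simp only [Function.update_self] at hi
      omega
    have h1 : ∀ k, _root_.extendDesign v D b φ (insert (i, k) S)
        = (v b - D b) * ∑ P ∈ Finset.powersetCard (D b) Finset.univ,
          inclusionCoeff (Fintype.card κ) (D b) (D b - (P ∩ blockPart S b).card)
            * φ (insert (i, k) (replaceBlock S b P)) := by
      intro k
      rw [_root_.extendDesign, if_neg (by rwa [blockDeg_insert_of_ne _ _ hib])]
      simp only [blockPart_insert_of_ne _ _ hib, replaceBlock_insert_of_ne _ _ _ hib]
    simp only [h1]
    rw [← Finset.mul_sum, Finset.sum_comm, _root_.extendDesign, if_neg hSb, mul_left_comm,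
      Finset.mul_sum (a := v i)]
    congr 1
    refine Finset.sum_congr rfl fun P hP => ?_
    rw [← Finset.mul_sum, hφ i _ (hS.replaceBlock hP)]
    · ring
    · rw [blockDeg_replaceBlock_of_ne _ _ hib]
      simpa [hib] using hi

omit [Fintype β] in
lemma abs_extendDesign_le {v : β → ℝ} {D : β → ℕ} {φ : Finset (β × κ) → ℝ} {b : β}
    (hb : 3 * D b ≤ Fintype.card κ) (hκ : 0 < Fintype.card κ) {V B : ℝ} (hV : 1 ≤ V)
    (hv : |v b - D b| ≤ V) (hφ : ∀ S, IsLow D S → |φ S| ≤ B) {S : Finset (β × κ)}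
    (hS : IsLow (Function.update D b (D b + 1)) S) :
    |extendDesign v D b φ S| ≤ V * 2 ^ Fintype.card κ * B := by
  have hB : 0 ≤ B := (abs_nonneg _).trans (hφ ∅ fun i => by simp [blockDeg])
  have h2 : (1 : ℝ) ≤ 2 ^ Fintype.card κ := one_le_pow₀ (by norm_num)
  rw [extendDesign]
  split_ifs with h
  · have hSlow : IsLow D S := by
      intro j
      by_cases hj : j = b
      · exact hj ▸ h
      · simpa [hj] using hS j
    refine (hφ S hSlow).trans (le_mul_of_one_le_left hB ?_)
    exact one_le_mul_of_one_le_of_one_le hV h2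
  · rw [abs_mul, mul_assoc]
    refine mul_le_mul hv ?_ (abs_nonneg _) (by linarith)
    refine (Finset.abs_sum_le_sum_abs _ _).trans ?_
    have h3 : ∀ P ∈ Finset.powersetCard (D b) (Finset.univ : Finset κ),
        |inclusionCoeff (Fintype.card κ) (D b) (D b - (P ∩ blockPart S b).card)
          * φ (replaceBlock S b P)| ≤ B := by
      intro P hP
      rw [abs_mul]
      exact (mul_le_of_le_one_left (abs_nonneg _)
        (abs_inclusionCoeff_le_one hκ hb (Nat.sub_le _ _))).trans (hφ _ (hS.replaceBlock hP))
    refine (Finset.sum_le_card_nsmul _ _ _ h3).trans ?_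
    rw [nsmul_eq_mul]
    refine mul_le_mul_of_nonneg_right ?_ hB
    have h4 : (Finset.powersetCard (D b) (Finset.univ : Finset κ)).card ≤ 2 ^ Fintype.card κ := by
      rw [Finset.card_powersetCard, Finset.card_univ]
      exact Nat.choose_le_two_pow _ _
    exact_mod_cast h4

omit [Fintype β] [Fintype κ] in
lemma IsLow.insert {D : β → ℕ} {S : Finset (β × κ)} (hS : IsLow D S) (b : β) (k : κ) :
    IsLow (Function.update D b (D b + 1)) (insert (b, k) S) := by
  intro i
  have h1 := blockDeg_insert_le S b k i
  have h2 := hS i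
  by_cases h : i = b
  · subst h
    simp only [if_true] at h1
    simp only [Function.update_self]
    omega
  · simp only [h, if_false] at h1
    simp only [Function.update_of_ne h]
    omega

omit [Fintype β] in
-- Inserting a fixed element uses up at most one degree of its block, which the spare degree in `b`
-- pays for.
lemma IsKnapsackDesign.shift {v : β → ℝ} {D : β → ℕ} {φ : Finset (β × κ) → ℝ} {b : β}
    (hφ : IsKnapsackDesign v (Function.update D b (D b + 1)) φ) (k : κ) :
    IsKnapsackDesign v D fun S => φ (insert (b, k) S) := by
  intro i S hS hi
  simp only
  rw [← hφ i (insert (b, k) S) (hS.insert b k)]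
  · simp only [Finset.insert_comm]
  · have h1 := blockDeg_insert_le S b k i
    by_cases h : i = b
    · subst h
      simp only [if_true] at h1
      simp only [Function.update_self]
      omega
    · simp only [h, if_false] at h1
      simp only [Function.update_of_ne h]
      omega

omit [Fintype β] in
lemma IsKnapsackDesign.sub {v : β → ℝ} {D : β → ℕ} {φ ψ : Finset (β × κ) → ℝ}
    (hφ : IsKnapsackDesign v D φ) (hψ : IsKnapsackDesign v D ψ) :
    IsKnapsackDesign v D fun S => φ S - ψ S := by
  intro i S hS hi
  rw [Finset.sum_sub_distrib, hφ i S hS hi, hψ i S hS hi]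
  ring

/-! ### The initial design. -/

/-- The design of the uniform distribution on the points with `v i` ones in the block `i`,
continued polynomially to real `v i`. -/
noncomputable def uniformDesign (v : β → ℝ) (S : Finset (β × κ)) : ℝ :=
  ∏ i, ∏ t ∈ Finset.range (blockDeg S i), (v i - t) / ((Fintype.card κ : ℝ) - t)

lemma uniformDesign_insert (v : β → ℝ) {S : Finset (β × κ)} {i : β} {k : κ} (h : (i, k) ∉ S) :
    uniformDesign v (insert (i, k) S) =
      (v i - blockDeg S i) / ((Fintype.card κ : ℝ) - blockDeg S i) * uniformDesign v S := by
  rw [uniformDesign, uniformDesign, ← Finset.mul_prod_erase _ _ (Finset.mem_univ i),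
    ← Finset.mul_prod_erase (a := i) Finset.univ (fun j => ∏ t ∈ Finset.range (blockDeg S j),
      (v j - t) / ((Fintype.card κ : ℝ) - t)) (Finset.mem_univ i), blockDeg_insert_of_notMem h,
    Finset.prod_range_succ]
  have : ∀ j ∈ Finset.univ.erase i, (∏ t ∈ Finset.range (blockDeg (insert (i, k) S) j),
      (v j - t) / ((Fintype.card κ : ℝ) - t)) = ∏ t ∈ Finset.range (blockDeg S j),
      (v j - t) / ((Fintype.card κ : ℝ) - t) := by
    intro j hj
    rw [blockDeg_insert_of_ne _ _ (Finset.ne_of_mem_erase hj).symm]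
  rw [Finset.prod_congr rfl this]
  ring

/-- If `S` has degree `e` in block `i`, then `e` summands equal `φ S` and `N - e` equal `(v i - e) /
(N - e) * φ S`. -/
lemma isKnapsackDesign_uniformDesign (v : β → ℝ) {D : β → ℕ}
    (hD : ∀ i, D i ≤ Fintype.card κ) :
    IsKnapsackDesign v D (uniformDesign (κ := κ) v) := by
  intro i S hS hi
  rw [← Finset.sum_add_sum_compl (blockPart S i)]
  have h1 : ∀ k ∈ blockPart S i, uniformDesign v (insert (i, k) S) = uniformDesign v S :=
    fun k hk => by rw [Finset.insert_eq_of_mem (mem_blockPart.1 hk)]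
  have h2 : ∀ k ∈ (blockPart S i)ᶜ, uniformDesign v (insert (i, k) S) =
      (v i - blockDeg S i) / ((Fintype.card κ : ℝ) - blockDeg S i) * uniformDesign v S :=
    fun k hk => uniformDesign_insert v (by rwa [Finset.mem_compl, mem_blockPart] at hk)
  have h3 : blockDeg S i < Fintype.card κ := hi.trans_le (hD i)
  have h4 : (Fintype.card κ : ℝ) - blockDeg S i ≠ 0 := by
    have : (blockDeg S i : ℝ) < Fintype.card κ := by exact_mod_cast h3
    intro; linarith
  rw [Finset.sum_congr rfl h1, Finset.sum_congr rfl h2, Finset.sum_const, Finset.sum_const,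
    Finset.card_compl, card_blockPart, nsmul_eq_mul, nsmul_eq_mul, Nat.cast_sub h3.le]
  field_simp
  ring

omit [DecidableEq κ] in
-- Each factor is at most `2`, because `N - t` exceeds `2 * N / 3` for `t < d`.
lemma abs_uniformDesign_le {v : β → ℝ} {d : ℕ} (hd : 3 * d ≤ Fintype.card κ)
    (hv : ∀ i, ∀ t < d, |v i - t| ≤ Fintype.card κ + 1) {S : Finset (β × κ)}
    (hS : IsLow (fun _ => d) S) :
    |uniformDesign v S| ≤ (2 ^ Fintype.card κ) ^ Fintype.card β := by
  rw [uniformDesign, Finset.abs_prod, ← Finset.card_univ (α := β), ← Finset.prod_const]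
  refine Finset.prod_le_prod (fun _ _ => abs_nonneg _) fun i _ => ?_
  have hSi : blockDeg S i ≤ d := hS i
  rw [Finset.abs_prod]
  have h1 : ∀ t ∈ Finset.range (blockDeg S i),
      |(v i - t) / ((Fintype.card κ : ℝ) - t)| ≤ 2 := by
    intro t ht
    have ht' : t + 1 ≤ d := by have := Finset.mem_range.1 ht; omega
    have h2 : (t : ℝ) + 1 ≤ d := by exact_mod_cast ht'
    have h3 : (3 : ℝ) * d ≤ Fintype.card κ := by exact_mod_cast hd
    have h0 : (0 : ℝ) ≤ t := Nat.cast_nonneg t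
    rw [abs_div, abs_of_pos (a := (Fintype.card κ : ℝ) - t) (by linarith),
      div_le_iff₀ (by linarith)]
    have := hv i t ht'
    linarith
  refine (Finset.prod_le_prod (fun _ _ => abs_nonneg _) h1).trans ?_
  rw [Finset.prod_const, Finset.card_range]
  exact pow_le_pow_right₀ (by norm_num) (by omega)

end Blocks

/-! ### Designs as linear functionals on polynomials. -/

section Functional

variable {ι : Type*} [DecidableEq ι]

/-- The linear functional on polynomials with value `φ S` at every monomial with support `S`. -/
noncomputable def designFunctional (φ : Finset ι → ℝ) : MvPolynomial ι ℚ →ₗ[ℚ] ℝ :=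
  (MvPolynomial.basisMonomials ι ℚ).constr ℚ fun m => φ m.support

omit [DecidableEq ι] in
lemma designFunctional_monomial (φ : Finset ι → ℝ) (m : ι →₀ ℕ) (c : ℚ) :
    designFunctional φ (MvPolynomial.monomial m c) = c * φ m.support := by
  have h : MvPolynomial.monomial m c = c • MvPolynomial.basisMonomials ι ℚ m := by
    rw [MvPolynomial.coe_basisMonomials, MvPolynomial.smul_monomial, smul_eq_mul, mul_one]
  rw [h, map_smul, designFunctional, Module.Basis.constr_basis, Rat.smul_def]

omit [DecidableEq ι] in
lemma designFunctional_C_mul (φ : Finset ι → ℝ) (c : ℚ) (p : MvPolynomial ι ℚ) :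
    designFunctional φ (MvPolynomial.C c * p) = c * designFunctional φ p := by
  rw [MvPolynomial.C_mul', map_smul, Rat.smul_def]

omit [DecidableEq ι] in
lemma designFunctional_one (φ : Finset ι → ℝ) : designFunctional φ 1 = φ ∅ := by
  rw [← MvPolynomial.C_1, ← MvPolynomial.monomial_zero', designFunctional_monomial]
  simp

/-- The functional sees only supports, so multiplying by a variable inserts it whether or not it
already occurs; in particular `x ^ 2` and `x` get the same value. -/
lemma designFunctional_X_mul (φ : Finset ι → ℝ) (a : ι) (p : MvPolynomial ι ℚ) :
    designFunctional φ (MvPolynomial.X a * p)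
      = designFunctional (fun S => φ (insert a S)) p := by
  induction p using MvPolynomial.induction_on' with
  | monomial m c =>
    have h : (Finsupp.single a 1 + m).support = insert a m.support := by
      ext i
      by_cases hi : i = a
      · subst hi; simp
      · simp [hi]
    rw [MvPolynomial.X, MvPolynomial.monomial_mul, one_mul, designFunctional_monomial,
      designFunctional_monomial, h]
  | add p q hp hq => rw [mul_add, map_add, map_add, hp, hq]

omit [DecidableEq ι] in
lemma designFunctional_congr {φ ψ : Finset ι → ℝ} {p : MvPolynomial ι ℚ}
    (h : ∀ m ∈ p.support, φ m.support = ψ m.support) :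
    designFunctional φ p = designFunctional ψ p := by
  rw [p.as_sum, map_sum, map_sum]
  refine Finset.sum_congr rfl fun m hm => ?_
  rw [designFunctional_monomial, designFunctional_monomial, h m hm]

omit [DecidableEq ι] in
lemma designFunctional_sub_fun (φ ψ : Finset ι → ℝ) (p : MvPolynomial ι ℚ) :
    designFunctional (fun S => φ S - ψ S) p = designFunctional φ p - designFunctional ψ p := by
  induction p using MvPolynomial.induction_on' with
  | monomial m c => simp only [designFunctional_monomial, mul_sub]
  | add p q hp hq => rw [map_add, map_add, map_add, hp, hq]; ring

end Functional

/-! ### Restrictions that keep one variable of each couple. -/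

section Restriction

variable {n : ℕ}

/-- The index of the couple of twin pairs to which a twin pair belongs. -/
def couple (s : KSIndex n) : Fin n × Fin n := (s.1, (finProdFinEquiv.symm s.2).2)

/-- The position of a twin pair in its couple. -/
def coupleSide (s : KSIndex n) : Fin 2 := (finProdFinEquiv.symm s.2).1

/-- The image of the variable `x_s` under the restriction that keeps the twin pair with position
`(ρ c).1` free in every couple `c`, and assigns `(ρ c).2` to the other one. -/
noncomputable def restrictVar (ρ : Fin n × Fin n → Fin 2 × Bool) (s : KSIndex n) :
    MvPolynomial (Fin n × Fin n) ℚ :=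
  if coupleSide s = (ρ (couple s)).1 then MvPolynomial.X (couple s)
  else if (ρ (couple s)).2 then 1 else 0

/-- The image of a literal under a restriction. -/
noncomputable def restrictLit (ρ : Fin n × Fin n → Fin 2 × Bool) :
    KSIndex n ⊕ KSIndex n → MvPolynomial (Fin n × Fin n) ℚ :=
  Sum.elim (restrictVar ρ) fun s => 1 - restrictVar ρ s

/-- Restriction of polynomials. -/
noncomputable def restrictPoly (ρ : Fin n × Fin n → Fin 2 × Bool) :
    TwinPoly (KSIndex n) →ₐ[ℚ] MvPolynomial (Fin n × Fin n) ℚ :=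
  MvPolynomial.aeval (restrictLit ρ)

/-- The couple of a literal. -/
def litCouple (y : KSIndex n ⊕ KSIndex n) : Fin n × Fin n := couple (y.elim id id)

/-- The choice for the couple of a literal that sets this literal to zero. -/
def killChoice : KSIndex n ⊕ KSIndex n → Fin 2 × Bool
  | Sum.inl s => (coupleSide s + 1, false)
  | Sum.inr s => (coupleSide s + 1, true)

lemma restrictLit_eq_zero {ρ : Fin n × Fin n → Fin 2 × Bool} {y : KSIndex n ⊕ KSIndex n}
    (h : ρ (litCouple y) = killChoice y) : restrictLit ρ y = 0 := by
  have h2 : ∀ a : Fin 2, ¬ a = a + 1 := by decide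
  rcases y with s | s <;> simp only [litCouple, Sum.elim_inl, Sum.elim_inr, id, killChoice] at h <;>
    simp [restrictLit, restrictVar, h, h2]

/-- The couples of the variables of a monomial. -/
def touched (m : (KSIndex n ⊕ KSIndex n) →₀ ℕ) : Finset (Fin n × Fin n) :=
  m.support.image litCouple

lemma vars_restrictLit_subset (ρ : Fin n × Fin n → Fin 2 × Bool)
    (y : KSIndex n ⊕ KSIndex n) : (restrictLit ρ y).vars ⊆ {litCouple y} := by
  have h : ∀ s, (restrictVar ρ s).vars ⊆ {couple s} := by
    intro s
    rw [restrictVar]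
    split_ifs
    · rw [MvPolynomial.vars_X]
    · simp
    · simp
  rcases y with s | s
  · exact h s
  · refine (MvPolynomial.vars_sub_subset _).trans ?_
    rw [MvPolynomial.vars_one, Finset.empty_union]
    exact h s

lemma vars_restrictPoly_monomial_subset (ρ : Fin n × Fin n → Fin 2 × Bool)
    (m : (KSIndex n ⊕ KSIndex n) →₀ ℕ) (c : ℚ) :
    (restrictPoly ρ (MvPolynomial.monomial m c)).vars ⊆ touched m := by
  rw [restrictPoly, MvPolynomial.aeval_monomial, MvPolynomial.algebraMap_eq]
  refine (MvPolynomial.vars_mul _ _).trans ?_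
  rw [MvPolynomial.vars_C, Finset.empty_union]
  refine (MvPolynomial.vars_prod _).trans ?_
  intro a ha
  obtain ⟨y, hy, hay⟩ := Finset.mem_biUnion.1 ha
  have := vars_restrictLit_subset ρ y (MvPolynomial.vars_pow _ _ hay)
  rw [Finset.mem_singleton] at this
  exact Finset.mem_image.2 ⟨y, hy, this.symm⟩

lemma restrictPoly_monomial_eq_zero {ρ : Fin n × Fin n → Fin 2 × Bool}
    {m : (KSIndex n ⊕ KSIndex n) →₀ ℕ} {y : KSIndex n ⊕ KSIndex n} (hy : y ∈ m.support)
    (h : ρ (litCouple y) = killChoice y) (c : ℚ) :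
    restrictPoly ρ (MvPolynomial.monomial m c) = 0 := by
  rw [restrictPoly, MvPolynomial.aeval_monomial, Finsupp.prod,
    Finset.prod_eq_zero hy, mul_zero]
  rw [restrictLit_eq_zero h, zero_pow (Finsupp.mem_support_iff.1 hy)]

/-- The restriction `ρ` sets every monomial in `M` to zero that touches more than `d` couples of
some block. -/
def KillsHighDegree (ρ : Fin n × Fin n → Fin 2 × Bool) (d : ℕ)
    (M : Finset ((KSIndex n ⊕ KSIndex n) →₀ ℕ)) : Prop :=
  ∀ m ∈ M, ¬ IsLow (fun _ => d) (touched m) →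
    ∃ y ∈ m.support, ρ (litCouple y) = killChoice y

lemma isLow_support_of_killsHighDegree {ρ : Fin n × Fin n → Fin 2 × Bool} {d : ℕ}
    {M : Finset ((KSIndex n ⊕ KSIndex n) →₀ ℕ)} (hρ : KillsHighDegree ρ d M)
    {p : TwinPoly (KSIndex n)} (hp : p.support ⊆ M) {a : (Fin n × Fin n) →₀ ℕ}
    (ha : a ∈ (restrictPoly ρ p).support) : IsLow (fun _ => d) a.support := by
  rw [p.as_sum, map_sum] at ha
  obtain ⟨m, hm, ha⟩ := Finset.mem_biUnion.1 (MvPolynomial.support_sum ha)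
  by_cases hlow : IsLow (fun _ => d) (touched m)
  · intro i
    refine le_trans (blockDeg_mono (fun b hb => ?_) i) (hlow i)
    exact vars_restrictPoly_monomial_subset ρ m _ (MvPolynomial.mem_vars_iff_mem_support b |>.2 ⟨a, ha, hb⟩)
  · obtain ⟨y, hy, h⟩ := hρ m (hp hm) hlow
    rw [restrictPoly_monomial_eq_zero hy h] at ha
    simp at ha

end Restriction

/-! ### Existence of a killing restriction by counting. -/

/-- Given few sets of at least `t` conditions `ρ c = f m c`, some `ρ` satisfies a condition from
each of them. -/
lemma exists_forall_exists_eq {ι α μ : Type*} [Fintype ι] [DecidableEq ι] [Fintype α]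
    [DecidableEq α] [Nonempty α] (M : Finset μ) (T : μ → Finset ι) (f : μ → ι → α) (t : ℕ)
    (hT : ∀ m ∈ M, t ≤ (T m).card)
    (h : M.card * (Fintype.card α - 1) ^ t < Fintype.card α ^ t) :
    ∃ ρ : ι → α, ∀ m ∈ M, ∃ c ∈ T m, ρ c = f m c := by
  classical
  by_contra! hcon
  set q := Fintype.card α with hq
  -- `A m` consists of the `ρ` violating all conditions of `m`, a fraction of at most `((q - 1) / q)
  -- ^ t`; the union of these sets cannot be everything.
  let A : μ → Finset (ι → α) := fun m =>
    Fintype.piFinset fun c => if c ∈ T m then Finset.univ.erase (f m c) else Finset.univ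
  obtain ⟨m₀, hm₀, -⟩ := hcon fun _ => Classical.arbitrary α
  have htι : t ≤ Fintype.card ι := (hT m₀ hm₀).trans (Finset.card_le_univ _)
  have hq0 : 0 < q := Fintype.card_pos
  have hA : ∀ m ∈ M, (A m).card ≤ (q - 1) ^ t * q ^ (Fintype.card ι - t) := by
    intro m hm
    have h1 : ∀ c, (if c ∈ T m then Finset.univ.erase (f m c) else Finset.univ).card
        = if c ∈ T m then q - 1 else q := by
      intro c
      split_ifs
      · rw [Finset.card_erase_of_mem (Finset.mem_univ _), Finset.card_univ]
      · rw [Finset.card_univ]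
    have h2 : (Finset.univ.filter fun c => c ∈ T m) = T m := by ext; simp
    have h3 := Finset.card_filter_add_card_filter_not (s := (Finset.univ : Finset ι)) (· ∈ T m)
    rw [h2, Finset.card_univ] at h3
    obtain ⟨s, hs⟩ := Nat.exists_eq_add_of_le (hT m hm)
    simp only [A]
    rw [Fintype.card_piFinset, Finset.prod_congr rfl fun c _ => h1 c, Finset.prod_ite,
      Finset.prod_const, Finset.prod_const, h2, hs, pow_add, mul_assoc]
    refine Nat.mul_le_mul_left _ ?_
    have h4 : Fintype.card ι - t = s + (Finset.univ.filter fun c => c ∉ T m).card := by omega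
    rw [h4, pow_add]
    exact Nat.mul_le_mul_right _ (Nat.pow_le_pow_left (Nat.sub_le _ _) _)
  have hcover : (Finset.univ : Finset (ι → α)) ⊆ M.biUnion A := by
    intro ρ _
    obtain ⟨m, hm, hρ⟩ := hcon ρ
    refine Finset.mem_biUnion.2 ⟨m, hm, Fintype.mem_piFinset.2 fun c => ?_⟩
    split_ifs with hc
    · exact Finset.mem_erase.2 ⟨hρ c hc, Finset.mem_univ _⟩
    · exact Finset.mem_univ _
  have h5 := (Finset.card_le_card hcover).trans
    (Finset.card_biUnion_le.trans (Finset.sum_le_card_nsmul _ _ _ hA))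
  rw [Finset.card_univ, Fintype.card_fun, smul_eq_mul, ← mul_assoc] at h5
  have h6 := Nat.mul_lt_mul_of_pos_right h (Nat.pow_pos (n := Fintype.card ι - t) hq0)
  rw [← pow_add, Nat.add_sub_cancel' htι] at h6
  exact absurd h5 h6.not_ge

/-- One literal is selected in each touched couple; one of the four choices for the couple kills it,
so a fraction of at most `(3/4) ^ (d + 1)` of the restrictions spares a given monomial. -/
lemma exists_killsHighDegree {n d : ℕ} (M : Finset ((KSIndex n ⊕ KSIndex n) →₀ ℕ))
    (h : M.card * 3 ^ (d + 1) < 4 ^ (d + 1)) :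
    ∃ ρ : Fin n × Fin n → Fin 2 × Bool, KillsHighDegree ρ d M := by
  classical
  let f : ((KSIndex n ⊕ KSIndex n) →₀ ℕ) → Fin n × Fin n → Fin 2 × Bool := fun m c =>
    -- The default is irrelevant: only touched couples carry a condition.
    if hc : ∃ y ∈ m.support, litCouple y = c then killChoice hc.choose else (0, false)
  obtain ⟨ρ, hρ⟩ := exists_forall_exists_eq
    (M.filter fun m => ¬ IsLow (fun _ => d) (touched m)) touched f (d + 1)
    (by
      intro m hm
      have hm2 := (Finset.mem_filter.1 hm).2
      rw [IsLow, not_forall] at hm2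
      obtain ⟨i, hi⟩ := hm2
      have : blockDeg (touched m) i ≤ (touched m).card := Finset.card_filter_le _ _
      omega)
    (by
      simp only [Fintype.card_prod, Fintype.card_fin, Fintype.card_bool]
      exact (Nat.mul_le_mul_right _ (Finset.card_filter_le _ _)).trans_lt h)
  refine ⟨ρ, fun m hm hlow => ?_⟩
  obtain ⟨c, hc, hρc⟩ := hρ m (Finset.mem_filter.2 ⟨hm, hlow⟩)
  have hc' : ∃ y ∈ m.support, litCouple y = c := Finset.mem_image.1 hc
  simp only [f, dif_pos hc'] at hρc
  exact ⟨hc'.choose, hc'.choose_spec.1, by rw [hc'.choose_spec.2, hρc]⟩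

/-! ### Absorbing a literal into a design. -/

section Lift

variable {β κ : Type*} [DecidableEq β] [Fintype κ] [DecidableEq κ]

/-- A product with a restricted literal is evaluated by a design like the other factor is by a
design with a slightly worse bound. -/
lemma exists_design_of_literal_mul {v : β → ℝ} {d : ℕ} (hd : 3 * d ≤ Fintype.card κ)
    (hκ : 0 < Fintype.card κ) {V B : ℝ} (hV : 1 ≤ V) (hv : ∀ i, |v i - d| ≤ V)
    {φ : Finset (β × κ) → ℝ} (hφ : IsKnapsackDesign v (fun _ => d) φ)
    (hB : ∀ S, IsLow (fun _ => d) S → |φ S| ≤ B) {u p : MvPolynomial (β × κ) ℚ} {a : β × κ}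
    (hu : u = 0 ∨ u = 1 ∨ u = MvPolynomial.X a ∨ u = 1 - MvPolynomial.X a)
    (hup : ∀ m ∈ (u * p).support, IsLow (fun _ => d) m.support) :
    ∃ ψ : Finset (β × κ) → ℝ, IsKnapsackDesign v (fun _ => d) ψ ∧
      (∀ S, IsLow (fun _ => d) S → |ψ S| ≤ 2 * V * 2 ^ Fintype.card κ * B) ∧
      designFunctional φ (u * p) = designFunctional ψ p := by
  obtain ⟨b, k⟩ := a
  have hB0 : 0 ≤ B := (abs_nonneg _).trans (hB ∅ fun i => by simp [blockDeg])
  have h2 : (1 : ℝ) ≤ 2 ^ Fintype.card κ := one_le_pow₀ (by norm_num)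
  have hV2 : 1 ≤ V * 2 ^ Fintype.card κ := one_le_mul_of_one_le_of_one_le hV h2
  have hVB : B ≤ V * 2 ^ Fintype.card κ * B := le_mul_of_one_le_left hB0 hV2
  have hle : B ≤ 2 * V * 2 ^ Fintype.card κ * B := by nlinarith
  let D : β → ℕ := fun _ => d
  -- The spare degree in `b` lets the shift by `(b, k)` remain a design in degree `d`. The extension
  -- does not change the value of `u * p`, whose monomials are low.
  have hφ' : IsKnapsackDesign v (Function.update D b (D b + 1)) (extendDesign v D b φ) :=
    IsKnapsackDesign.extendDesign hφ b (by omega)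
  have hB' : ∀ S, IsLow (Function.update D b (D b + 1)) S →
      |extendDesign v D b φ S| ≤ V * 2 ^ Fintype.card κ * B :=
    fun S hS => abs_extendDesign_le hd hκ hV (hv b) hB hS
  have hcongr : designFunctional φ (u * p) = designFunctional (extendDesign v D b φ) (u * p) :=
    designFunctional_congr fun m hm => (extendDesign_of_le (hup m hm b)).symm
  have hmono : ∀ S : Finset (β × κ), IsLow D S → IsLow (Function.update D b (D b + 1)) S := by
    intro S hS i
    refine (hS i).trans ?_
    by_cases h : i = b
    · subst h; simp
    · simp [h]
  have hagree : IsKnapsackDesign v D (extendDesign v D b φ) := by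
    intro i S hS hi
    refine hφ' i S (hmono S hS) (hi.trans_le ?_)
    by_cases h : i = b
    · subst h; simp
    · simp [h]
  rcases hu with rfl | rfl | rfl | rfl
  · refine ⟨fun _ => 0, fun i S _ _ => by simp, fun S _ => by simpa using hB0.trans hle, ?_⟩
    rw [zero_mul, map_zero, designFunctional_congr (ψ := fun S => φ S - φ S)
      (fun m _ => (sub_self _).symm), designFunctional_sub_fun, sub_self]
  · exact ⟨φ, hφ, fun S hS => (hB S hS).trans hle, by rw [one_mul]⟩
  · refine ⟨fun S => extendDesign v D b φ (insert (b, k) S), hφ'.shift k, fun S hS => ?_, ?_⟩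
    · refine (hB' _ (IsLow.insert hS b k)).trans ?_
      nlinarith
    · rw [hcongr, designFunctional_X_mul]
  · refine ⟨fun S => extendDesign v D b φ S - extendDesign v D b φ (insert (b, k) S),
      hagree.sub (hφ'.shift k), fun S hS => ?_, ?_⟩
    · refine (abs_sub _ _).trans ?_
      have h3 := hB' _ (IsLow.insert (D := D) hS b k)
      have h4 := hB' S (hmono S hS)
      linarith
    · rw [hcongr, sub_mul, one_mul, map_sub, designFunctional_X_mul,
        designFunctional_sub_fun]

end Lift

/-! ### Values of the restricted axioms. -/

section Axioms

variable {n : ℕ}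

lemma restrictLit_cases (ρ : Fin n × Fin n → Fin 2 × Bool) (y : KSIndex n ⊕ KSIndex n) :
    restrictLit ρ y = 0 ∨ restrictLit ρ y = 1 ∨ restrictLit ρ y = MvPolynomial.X (litCouple y) ∨
      restrictLit ρ y = 1 - MvPolynomial.X (litCouple y) := by
  rcases y with s | s <;>
    simp only [restrictLit, restrictVar, litCouple, Sum.elim_inl, Sum.elim_inr, id] <;>
    split_ifs <;> simp

/-- The number of ones missing in the block `i` after the restriction `ρ`. -/
def missingOnes (ρ : Fin n × Fin n → Fin 2 × Bool) (i : Fin n) : ℚ :=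
  n - ∑ k, if (ρ (i, k)).2 then 1 else 0

lemma missingOnes_mem_Icc (ρ : Fin n × Fin n → Fin 2 × Bool) (i : Fin n) :
    missingOnes ρ i ∈ Set.Icc (0 : ℚ) n := by
  have h0 : (0 : ℚ) ≤ ∑ k, if (ρ (i, k)).2 then 1 else 0 :=
    Finset.sum_nonneg fun k _ => by split_ifs <;> norm_num
  have h1 : (∑ k, if (ρ (i, k)).2 then 1 else 0) ≤ ∑ _k : Fin n, (1 : ℚ) :=
    Finset.sum_le_sum fun k _ => by split_ifs <;> norm_num
  simp only [Finset.sum_const, Finset.card_univ, Fintype.card_fin, nsmul_eq_mul, mul_one] at h1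
  rw [missingOnes, Set.mem_Icc]
  constructor <;> linarith

/-- Each couple contributes its free variable plus the bit given to the other one. -/
lemma restrictPoly_ks (ρ : Fin n × Fin n → Fin 2 × Bool) (i : Fin n) :
    restrictPoly ρ (ks n i)
      = ∑ k, MvPolynomial.X (i, k) - MvPolynomial.C (missingOnes ρ i) := by
  have h : ∀ k, ∑ a : Fin 2, restrictVar ρ (i, finProdFinEquiv (a, k))
      = MvPolynomial.X (i, k) + MvPolynomial.C (if (ρ (i, k)).2 then 1 else 0) := by
    intro k
    simp only [restrictVar, coupleSide, couple, Equiv.symm_apply_apply, Fin.sum_univ_two]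
    rcases hρ : ρ (i, k) with ⟨a, c⟩
    fin_cases a <;> cases c <;> simp [add_comm]
  rw [ks, map_sub, map_sum]
  simp only [restrictPoly, MvPolynomial.aeval_X, MvPolynomial.aeval_C, restrictLit, Sum.elim_inl,
    MvPolynomial.algebraMap_eq]
  rw [← Equiv.sum_comp finProdFinEquiv, Fintype.sum_prod_type_right,
    Finset.sum_congr rfl fun k _ => h k, Finset.sum_add_distrib, missingOnes, map_sub, map_sum]
  ring

/-- The value that the sum of the free variables in the block `i` gets in a design for the
restricted constraints without the last one. -/
noncomputable def blockValue (ρ : Fin n × Fin n → Fin 2 × Bool) (i : Fin n) : ℝ :=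
  missingOnes ρ i + (1 / 2) ^ 2 ^ (i : ℕ)

lemma abs_blockValue_sub_le (ρ : Fin n × Fin n → Fin 2 × Bool) (i : Fin n) {t : ℕ} (ht : t ≤ n) :
    |blockValue ρ i - t| ≤ n + 1 := by
  obtain ⟨h0, h1⟩ := missingOnes_mem_Icc ρ i
  have h0' : (0 : ℝ) ≤ missingOnes ρ i := by exact_mod_cast h0
  have h1' : (missingOnes ρ i : ℝ) ≤ n := by exact_mod_cast h1
  have h2 : (0 : ℝ) ≤ (1 / 2) ^ 2 ^ (i : ℕ) := by positivity
  have h3 : (1 / 2 : ℝ) ^ 2 ^ (i : ℕ) ≤ 1 := pow_le_one₀ (by norm_num) (by norm_num)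
  have h4 : (t : ℝ) ≤ n := by exact_mod_cast ht
  have h5 : (0 : ℝ) ≤ t := Nat.cast_nonneg t
  rw [blockValue, abs_le]
  constructor <;> linarith

lemma designFunctional_sum_sub_mul (φ : Finset (Fin n × Fin n) → ℝ) (i : Fin n) (w : ℚ)
    (p : MvPolynomial (Fin n × Fin n) ℚ) :
    designFunctional φ ((∑ k, MvPolynomial.X (i, k) - MvPolynomial.C w) * p)
      = ∑ k, designFunctional (fun S => φ (insert (i, k) S)) p - w * designFunctional φ p := by
  rw [sub_mul, Finset.sum_mul, map_sub, map_sum, designFunctional_C_mul]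
  simp only [designFunctional_X_mul]

lemma isLow_of_card_le {d : ℕ} {S : Finset (Fin n × Fin n)} (h : S.card ≤ d) :
    IsLow (fun _ => d) S :=
  fun _ => (Finset.card_filter_le _ _).trans h

lemma designFunctional_ks {ρ : Fin n × Fin n → Fin 2 × Bool} {d : ℕ} (hd : 0 < d)
    {φ : Finset (Fin n × Fin n) → ℝ} (hφ : IsKnapsackDesign (blockValue ρ) (fun _ => d) φ)
    (i : Fin n) : designFunctional φ (restrictPoly ρ (ks n i)) = (1 / 2) ^ 2 ^ (i : ℕ) * φ ∅ := by
  rw [restrictPoly_ks, ← mul_one (_ - _), designFunctional_sum_sub_mul]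
  simp only [designFunctional_one]
  rw [hφ i ∅ (isLow_of_card_le (by simp)) (by simpa [blockDeg] using hd), blockValue]
  ring

lemma designFunctional_ks_sq {ρ : Fin n × Fin n → Fin 2 × Bool} {d : ℕ} (hd : 1 < d)
    {φ : Finset (Fin n × Fin n) → ℝ} (hφ : IsKnapsackDesign (blockValue ρ) (fun _ => d) φ)
    (i : Fin n) :
    designFunctional φ (restrictPoly ρ (ks n i ^ 2)) = (1 / 2) ^ 2 ^ ((i : ℕ) + 1) * φ ∅ := by
  have h1 : ∀ k, ∑ l, φ (insert (i, k) (insert (i, l) ∅)) = blockValue ρ i * φ {(i, k)} := by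
    intro k
    rw [← hφ i {(i, k)} (isLow_of_card_le (by simp; omega))
      (((Finset.card_filter_le _ _).trans (by simp)).trans_lt hd)]
    refine Finset.sum_congr rfl fun l _ => ?_
    rw [Finset.insert_comm]
    rfl
  have h2 : ∑ l, φ (insert (i, l) ∅) = blockValue ρ i * φ ∅ :=
    hφ i ∅ (isLow_of_card_le (by simp)) (by simp [blockDeg]; omega)
  have hL : ∀ χ : Finset (Fin n × Fin n) → ℝ, designFunctional χ
      (∑ k, MvPolynomial.X (i, k) - MvPolynomial.C (missingOnes ρ i))
        = ∑ k, χ (insert (i, k) ∅) - missingOnes ρ i * χ ∅ := by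
    intro χ
    rw [← mul_one (_ - _), designFunctional_sum_sub_mul]
    simp only [designFunctional_one]
  rw [map_pow, restrictPoly_ks, pow_two, designFunctional_sum_sub_mul]
  simp only [hL, h1]
  have h3 : ∑ k, φ {(i, k)} = blockValue ρ i * φ ∅ := h2
  rw [Finset.sum_sub_distrib, ← Finset.mul_sum, ← Finset.mul_sum, h3, h2, pow_succ 2, pow_mul,
    blockValue]
  ring

/-- The values `(1/2) ^ 2 ^ i` square to one another, so all constraints but the last vanish
exactly; `1 < d` makes room for the squares. -/
lemma abs_designFunctional_constraint_le {ρ : Fin n × Fin n → Fin 2 × Bool} {d : ℕ} (hd : 1 < d)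
    {φ : Finset (Fin n × Fin n) → ℝ} (hφ : IsKnapsackDesign (blockValue ρ) (fun _ => d) φ)
    {q : TwinPoly (KSIndex n)} (hq : q ∈ knapsackConstraints n) :
    |designFunctional φ (restrictPoly ρ q)| ≤ (1 / 2) ^ 2 ^ n * |φ ∅| := by
  have h0 : 0 ≤ (1 / 2 : ℝ) ^ 2 ^ n * |φ ∅| := by positivity
  rcases hq with ⟨i, hi, rfl⟩ | ⟨i, j, hij, rfl⟩ | ⟨i, hi, rfl⟩
  · rw [map_sub, map_sub, designFunctional_ks (by omega) hφ, restrictPoly, MvPolynomial.aeval_C,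
      MvPolynomial.algebraMap_eq, ← mul_one (MvPolynomial.C _), designFunctional_C_mul,
      designFunctional_one, hi]
    norm_num
  · rw [map_sub, map_sub, designFunctional_ks_sq hd hφ, designFunctional_ks (by omega) hφ, hij,
      sub_self, abs_zero]
    exact h0
  · rw [designFunctional_ks_sq hd hφ, hi, abs_mul, abs_of_nonneg (by positivity)]

lemma designFunctional_booleanAxiom (ρ : Fin n × Fin n → Fin 2 × Bool)
    (φ : Finset (Fin n × Fin n) → ℝ) {q : TwinPoly (KSIndex n)}
    (hq : q ∈ booleanAxioms (KSIndex n)) : designFunctional φ (restrictPoly ρ q) = 0 := by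
  obtain ⟨s, rfl | rfl⟩ := hq
  · simp only [restrictPoly, map_sub, map_pow, MvPolynomial.aeval_X, restrictLit, Sum.elim_inl]
    rw [restrictVar]
    split_ifs
    · rw [pow_two, ← mul_one (MvPolynomial.X _ * _), mul_assoc]
      nth_rw 3 [← mul_one (MvPolynomial.X _)]
      simp only [designFunctional_X_mul, designFunctional_one, Finset.mem_insert_self,
        Finset.insert_eq_of_mem, sub_self]
    · simp
    · simp
  · simp only [restrictPoly, map_sub, map_add, map_one, MvPolynomial.aeval_X, restrictLit,
      Sum.elim_inl, Sum.elim_inr]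
    ring

end Axioms

/-! ### Error propagation along the refutation. -/

section Refutation

variable {n : ℕ}

lemma PCRRefutation.support_line_subset {σ : Type*} {Q : Set (TwinPoly σ)} (Γ : PCRRefutation Q)
    (i : Fin (Γ.steps + 1)) : (Γ.line i).support ⊆ Γ.monomials := by
  classical
  intro m hm
  rw [PCRRefutation.monomials, Finset.mem_biUnion]
  exact ⟨i, Finset.mem_univ i, hm⟩

/-- The claim must range over all designs and bounds `B`, because a lift passes to a different
design for the premise. The hypothesis `hR` makes a lift as cheap as a linear combination. -/
lemma abs_designFunctional_line_le {Γ : PCRRefutation (knapsackConstraints n)} {R : ℝ}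
    (hΓ : ∀ i, (Γ.rule i).ScalarsLE R) {d : ℕ} (hd : 1 < d) (hdn : 3 * d ≤ n)
    {ρ : Fin n × Fin n → Fin 2 × Bool} (hρ : KillsHighDegree ρ d Γ.monomials)
    (hR : 2 * ((n : ℝ) + 1) * 2 ^ n ≤ 2 * R) (i : Fin (Γ.steps + 1))
    {φ : Finset (Fin n × Fin n) → ℝ} (hφ : IsKnapsackDesign (blockValue ρ) (fun _ => d) φ)
    {B : ℝ} (hB : ∀ S, IsLow (fun _ => d) S → |φ S| ≤ B) :
    |designFunctional φ (restrictPoly ρ (Γ.line i))|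
      ≤ (2 * R) ^ Γ.heightAt i * ((1 / 2) ^ 2 ^ n * B) := by
  induction i using WellFoundedLT.induction generalizing φ B with
  | _ i ih =>
  have hB0 : |φ ∅| ≤ B := hB ∅ (isLow_of_card_le (by simp))
  have hB1 : 0 ≤ B := (abs_nonneg _).trans hB0
  have hC : 1 ≤ 2 * ((n : ℝ) + 1) * 2 ^ n :=
    one_le_mul_of_one_le_of_one_le (by linarith [Nat.cast_nonneg (α := ℝ) n])
      (one_le_pow₀ (by norm_num))
  have hR1 : 1 ≤ 2 * R := hC.trans hR
  set ε : ℝ := (1 / 2) ^ 2 ^ n with hε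
  have hε0 : 0 ≤ ε := by positivity
  have hscal := hΓ i
  rw [PCRRefutation.heightAt]
  rcases hrule : Γ.rule i with h | h | ⟨j, hj, y, h⟩ | ⟨j, k, hj, hk, a, b, h⟩
  · simp only [pow_zero, one_mul]
    exact (abs_designFunctional_constraint_le hd hφ h).trans
      (mul_le_mul_of_nonneg_left hB0 hε0)
  · simp only [pow_zero, one_mul]
    rw [designFunctional_booleanAxiom ρ φ h, abs_zero]
    positivity
  · simp only
    have hline : restrictPoly ρ (Γ.line i) = restrictLit ρ y * restrictPoly ρ (Γ.line j) := by
      rw [h, map_mul, restrictPoly, MvPolynomial.aeval_X]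
    obtain ⟨ψ, hψ, hψB, hφψ⟩ := exists_design_of_literal_mul (V := (n : ℝ) + 1) (d := d)
      (p := restrictPoly ρ (Γ.line j)) (by rwa [Fintype.card_fin])
      (by rw [Fintype.card_fin]; omega) (by linarith [Nat.cast_nonneg (α := ℝ) n])
      (fun b => abs_blockValue_sub_le ρ b (by omega)) hφ hB (restrictLit_cases ρ y)
      (fun m hm => isLow_support_of_killsHighDegree hρ (Γ.support_line_subset i)
        (by rwa [hline]))
    rw [Fintype.card_fin] at hψB
    rw [hline, hφψ]
    -- The growth of the bound from `B` to that of `ψ` is charged to the additional step of height.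
    refine (ih j hj hψ hψB).trans ?_
    calc (2 * R) ^ Γ.heightAt j * (ε * (2 * ((n : ℝ) + 1) * 2 ^ n * B))
        = (2 * R) ^ Γ.heightAt j * (ε * B) * (2 * ((n : ℝ) + 1) * 2 ^ n) := by ring
      _ ≤ (2 * R) ^ Γ.heightAt j * (ε * B) * (2 * R) :=
          mul_le_mul_of_nonneg_left hR (by positivity)
      _ = (2 * R) ^ (Γ.heightAt j + 1) * (ε * B) := by ring
  · simp only
    rw [hrule] at hscal
    obtain ⟨ha, hb⟩ := hscal
    have hline : designFunctional φ (restrictPoly ρ (Γ.line i))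
        = a * designFunctional φ (restrictPoly ρ (Γ.line j))
          + b * designFunctional φ (restrictPoly ρ (Γ.line k)) := by
      rw [h, map_add, map_mul, map_mul, map_add, restrictPoly, MvPolynomial.aeval_C,
        MvPolynomial.aeval_C, MvPolynomial.algebraMap_eq, designFunctional_C_mul,
        designFunctional_C_mul]
    set H := max (Γ.heightAt j) (Γ.heightAt k) with hH
    have hX : 0 ≤ ε * B := mul_nonneg hε0 hB1
    have hj' : |designFunctional φ (restrictPoly ρ (Γ.line j))| ≤ (2 * R) ^ H * (ε * B) :=
      (ih j hj hφ hB).trans (mul_le_mul_of_nonneg_right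
        (pow_le_pow_right₀ hR1 (le_max_left _ _)) hX)
    have hk' : |designFunctional φ (restrictPoly ρ (Γ.line k))| ≤ (2 * R) ^ H * (ε * B) :=
      (ih k hk hφ hB).trans (mul_le_mul_of_nonneg_right
        (pow_le_pow_right₀ hR1 (le_max_right _ _)) hX)
    have hR0 : 0 ≤ R := by linarith
    rw [hline]
    refine (abs_add_le _ _).trans ?_
    rw [abs_mul, abs_mul]
    calc _ ≤ R * ((2 * R) ^ H * (ε * B)) + R * ((2 * R) ^ H * (ε * B)) :=
          add_le_add (mul_le_mul ha hj' (abs_nonneg _) hR0) (mul_le_mul hb hk' (abs_nonneg _) hR0)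
      _ = (2 * R) ^ (H + 1) * (ε * B) := by ring

lemma two_pow_le_of_killsHighDegree {Γ : PCRRefutation (knapsackConstraints n)} {R : ℝ}
    (hΓ : ∀ i, (Γ.rule i).ScalarsLE R) {d : ℕ} (hd : 1 < d) (hdn : 3 * d ≤ n)
    {ρ : Fin n × Fin n → Fin 2 × Bool} (hρ : KillsHighDegree ρ d Γ.monomials)
    (hR : 2 * ((n : ℝ) + 1) * 2 ^ n ≤ 2 * R) :
    (2 : ℝ) ^ 2 ^ n ≤ (2 * R) ^ Γ.height * (2 ^ n) ^ n := by
  have h := abs_designFunctional_line_le hΓ hd hdn hρ hR (Fin.last Γ.steps)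
    (isKnapsackDesign_uniformDesign (blockValue ρ) fun _ => by rw [Fintype.card_fin]; omega)
    (fun S hS => abs_uniformDesign_le (by rwa [Fintype.card_fin])
      (fun i t ht => by rw [Fintype.card_fin]; exact abs_blockValue_sub_le ρ i (by omega)) hS)
  rw [Γ.line_last, map_one, designFunctional_one, Fintype.card_fin] at h
  have h1 : uniformDesign (blockValue ρ) (∅ : Finset (Fin n × Fin n)) = 1 := by
    simp [uniformDesign, blockDeg]
  rw [h1, abs_one, one_div, inv_pow, mul_left_comm, inv_mul_eq_div, one_le_div (by positivity)] at h
  exact h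

lemma four_mul_sq_le_two_pow {n : ℕ} (hn : 8 ≤ n) : 4 * n ^ 2 ≤ 2 ^ n := by
  induction n, hn using Nat.le_induction with
  | base => norm_num
  | succ n hn ih => rw [pow_succ 2 n]; nlinarith

end Refutation

/-! ### The height bound. -/

theorem mainTheorem3 :
    ∃ c d : ℝ, 0 < c ∧ 0 < d ∧ ∃ N : ℕ, ∀ n : ℕ, N ≤ n →
      ∀ Γ : PCRRefutation (knapsackConstraints n),
        Γ.IsBounded ((2 : ℝ) ^ ((2 : ℝ) ^ ((n : ℝ) / 2))) →
        (Γ.monomials.card : ℝ) ≤ (2 : ℝ) ^ (d * (n : ℝ)) →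
        (2 : ℝ) ^ ((n : ℝ) / 2 - 2)
            - (c * (n : ℝ) + 2 * Real.logb 2 (n : ℝ)) / (2 : ℝ) ^ ((n : ℝ) / 2 + 2) - 1
          ≤ (Γ.height : ℝ) := by
  -- `1 / 12` is a third, from the degree cut `n / 3`, times `1 / 4`, from `2 ^ (1 / 4) < 4 / 3`.
  -- Any positive `c` would do, as the bound obtained is `2 ^ (n / 2) / 4`.
  refine ⟨1, 1 / 12, one_pos, by norm_num, 8, fun n hn Γ hΓ hmon => ?_⟩
  set s : ℝ := 2 ^ ((n : ℝ) / 2) with hs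
  have hs2 : s ^ 2 = 2 ^ n := by
    rw [hs, ← Real.rpow_natCast, ← Real.rpow_mul (by norm_num), ← Real.rpow_natCast]
    congr 1
    push_cast
    ring
  have hs0 : 0 < s := by positivity
  have hn' : (8 : ℝ) ≤ n := by exact_mod_cast hn
  have hpow : 4 * (n : ℝ) ^ 2 ≤ s ^ 2 := by
    rw [hs2]; exact_mod_cast four_mul_sq_le_two_pow hn
  have hns : 2 * (n : ℝ) ≤ s := by
    refine le_of_sq_le_sq ?_ hs0.le
    linarith
  have hR : 2 * ((n : ℝ) + 1) * 2 ^ n ≤ 2 * 2 ^ s := by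
    have h1 : (n : ℝ) + 1 ≤ 2 ^ n := by exact_mod_cast Nat.lt_two_pow_self (n := n)
    have h2 : (2 : ℝ) ^ (2 * (n : ℝ)) = 2 ^ n * 2 ^ n := by
      rw [two_mul, Real.rpow_add (by norm_num), Real.rpow_natCast]
    have h3 : (2 : ℝ) ^ (2 * (n : ℝ)) ≤ 2 ^ s := Real.rpow_le_rpow_of_exponent_le (by norm_num) hns
    have h4 : (0 : ℝ) < 2 ^ n := by positivity
    nlinarith
  obtain ⟨ρ, hρ⟩ : ∃ ρ : Fin n × Fin n → Fin 2 × Bool,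
      KillsHighDegree ρ (n / 3) Γ.monomials := by
    refine exists_killsHighDegree _ ?_
    set t := n / 3 + 1 with ht
    have h1 : (n : ℝ) ≤ 3 * t := by
      have : n ≤ 3 * t := by omega
      exact_mod_cast this
    have h2 : (Γ.monomials.card : ℝ) ≤ (2 ^ (1 / 4 : ℝ)) ^ t := by
      refine hmon.trans ?_
      rw [← Real.rpow_natCast, ← Real.rpow_mul (by norm_num)]
      exact Real.rpow_le_rpow_of_exponent_le (by norm_num) (by linarith)
    have h3 : (2 : ℝ) ^ (1 / 4 : ℝ) < 4 / 3 := by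
      rw [one_div, Real.rpow_inv_lt_iff_of_pos (by norm_num) (by norm_num) (by norm_num)]
      norm_num
    have h4 : (Γ.monomials.card : ℝ) < (4 / 3) ^ t :=
      h2.trans_lt (pow_lt_pow_left₀ h3 (by positivity) (by omega))
    rw [div_pow, lt_div_iff₀ (by positivity)] at h4
    exact_mod_cast h4
  have hmain := two_pow_le_of_killsHighDegree hΓ.2 (by omega) (by omega) hρ hR
  -- Base-two logarithms, with `2 ^ n = s ^ 2` and `2 * R = 2 ^ (1 + s)`.
  have hlog : s ^ 2 ≤ (1 + s) * Γ.height + n ^ 2 := by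
    have h1 : (2 * (2 : ℝ) ^ s) ^ Γ.height * (2 ^ n) ^ n
        = 2 ^ ((1 + s) * Γ.height + (n : ℝ) ^ 2) := by
      rw [Real.rpow_add (by norm_num), Real.rpow_mul (by norm_num), Real.rpow_add (by norm_num),
        Real.rpow_one, Real.rpow_natCast, ← pow_mul, ← pow_two]
      congr 1
      exact_mod_cast (Real.rpow_natCast 2 (n ^ 2)).symm
    have h2 : (2 : ℝ) ^ 2 ^ n = 2 ^ (s ^ 2) := by
      rw [hs2]
      exact_mod_cast (Real.rpow_natCast 2 (2 ^ n)).symm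
    rwa [h1, h2, Real.rpow_le_rpow_left_iff (by norm_num)] at hmain
  have hquot : 0 ≤ (1 * (n : ℝ) + 2 * Real.logb 2 n) / 2 ^ ((n : ℝ) / 2 + 2) := by
    have : 0 ≤ Real.logb 2 n := Real.logb_nonneg (by norm_num) (by linarith)
    positivity
  have hquarter : (2 : ℝ) ^ ((n : ℝ) / 2 - 2) = s / 4 := by
    rw [Real.rpow_sub (by norm_num), ← hs]
    norm_num
  rw [hquarter]
  suffices s / 4 ≤ Γ.height by linarith
  by_contra! hlt
  -- If the height were below `s / 4`, then `hlog` and `n ^ 2 ≤ s ^ 2 / 4` would give `s ^ 2 < s / 4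
  -- + s ^ 2 / 2`, impossible for `s ≥ 2 * n ≥ 16`.
  nlinarith
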